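/- For $\tau$ in the upper half-plane $\mathbb{H}$ put $q=e^{2\pi i\tau}$ and $q^a=e^{2\pi i a\tau}$, let $\eta(\tau)=q^{1/24}\prod_{n=1}^\infty(1-q^n)$ be the Dedekind eta function, and set $$f_1(\tau)=\frac{\sum_{n\in\mathbb{Z}}q^{n^2}}{\eta(\tau)},\qquad f_2(\tau)=\frac{\sum_{n\in\mathbb{Z}}q^{(n+1/2)^2}}{\eta(\tau)}.$$ Then for every $\tau\in\mathbb{H}$ these series and the infinite products below converge, $\eta(\tau)$, $\eta(2\tau)$, $f_1(\tau)$ and $f_2(\tau)$ are nonzero, and $$2\frac{f_1(\tau)}{f_2(\tau)}-2\frac{f_2(\tau)}{f_1(\tau)}=\left(\frac{\eta(\tau/2)}{\eta(2\tau)}\right)^4,\qquad (1)$$ $$f_1(\tau)^5f_2(\tau)-f_2(\tau)^5f_1(\tau)=2.\qquad (2)$$ Moreover, for every $\tau\in\mathbb{H}$, identity (2) at $\tau$ is equivalent to the Weber identity $$\prod_{n=1}^\infty(1+q^{2n-1})^8-16q\prod_{n=1}^\infty(1+q^{2n})^8=\prod_{n=1}^\infty(1-q^{2n-1})^8,\qquad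 (3)$$ and (3) holds. -/

import Mathlib

namespace ThetaWeber

noncomputable section

/-- The power `q ^ a = exp (2 π i a τ)`, where `q = exp (2 π i τ)`. -/
def qpow (a τ : ℂ) : ℂ := Complex.exp (2 * (Real.pi : ℂ) * Complex.I * a * τ)

/-- `f₁(τ) = (∑_{n ∈ ℤ} q ^ (n ^ 2)) / η(τ)`, with Mathlib's Dedekind eta function
`η(τ) = q ^ (1 / 24) ∏_{n ≥ 1} (1 - q ^ n)`. -/
def f₁ (τ : ℂ) : ℂ := (∑' n : ℤ, qpow ((n : ℂ) ^ 2) τ) / ModularForm.eta τ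

/-- `f₂(τ) = (∑_{n ∈ ℤ} q ^ ((n + 1 / 2) ^ 2)) / η(τ)`. -/
def f₂ (τ : ℂ) : ℂ := (∑' n : ℤ, qpow (((n : ℂ) + 1 / 2) ^ 2) τ) / ModularForm.eta τ

/-- The identity `∏_{n ≥ 1} (1 + q ^ (2 n - 1)) ^ 8 - 16 q ∏_{n ≥ 1} (1 + q ^ (2 n)) ^ 8
= ∏_{n ≥ 1} (1 - q ^ (2 n - 1)) ^ 8`, written with `n + 1` in place of `n`, where `n : ℕ`. -/
def WeberIdentity (q : ℂ) : Prop :=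
  (∏' n : ℕ, (1 + q ^ (2 * n + 1)) ^ 8) - 16 * q * (∏' n : ℕ, (1 + q ^ (2 * n + 2)) ^ 8)
    = ∏' n : ℕ, (1 - q ^ (2 * n + 1)) ^ 8

end

end ThetaWeber

/-! With q as nome, the two series are the theta constants θ₃ and θ₂. The Jacobi triple product
turns them, together with θ₄, into E A², 2 q^(1/4) E C² and E B², where A, B, C, E are `oddAdd`,
`oddSub`, `evenAdd`, `evenSub` at q. Since η = q^(1/24) B E, Euler's identity A C B = 1 converts (2)
into (3). The remaining input is the addition formula `jacobiTheta₂_mul_jacobiTheta₂`. For r² = q it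
gives θ₃² - θ₂² = θ₄(r)² and θ₃² + θ₂² = θ₃(r)². The former yields (1); the product of the two
yields θ₃⁴ - θ₂⁴ = θ₄⁴, which is (3), because θ₃(r) θ₄(r) = θ₄². -/

namespace ThetaWeber

open Complex Filter Topology

/-! ### The finite Jacobi triple product -/

/-- The reciprocal `1 / ((1 - q ^ 2) (1 - q ^ 4) ⋯ (1 - q ^ (2 m)))`, extended by `0` to negative
`m`. -/
noncomputable def invPoch (q : ℂ) : ℤ → ℂ
  | Int.ofNat n => (∏ k ∈ Finset.range n, (1 - q ^ (2 * k + 2)))⁻¹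
  | Int.negSucc _ => 0

lemma one_sub_pow_ne_zero {q : ℂ} (hq : ‖q‖ < 1) {n : ℕ} (hn : n ≠ 0) : 1 - q ^ n ≠ 0 := by
  rw [sub_ne_zero]
  intro h
  have h1 : ‖q ^ n‖ < 1 := by
    rw [norm_pow]
    exact pow_lt_one₀ (norm_nonneg _) hq hn
  simp [← h] at h1

lemma invPoch_of_neg (q : ℂ) {m : ℤ} (hm : m < 0) : invPoch q m = 0 := by
  obtain n | n := m
  · simp only [Int.ofNat_eq_natCast] at hm
    omega
  · rfl

lemma invPoch_natCast (q : ℂ) (n : ℕ) :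
    invPoch q n = (∏ k ∈ Finset.range n, (1 - q ^ (2 * k + 2)))⁻¹ := rfl

lemma invPoch_zero (q : ℂ) : invPoch q 0 = 1 := by
  simpa using invPoch_natCast q 0

/-- Extension by zero is consistent at m = 0, where the factor 1 - q ^ 0 vanishes, so no boundary
cases arise later. -/
lemma invPoch_sub_one {q : ℂ} (hq : ‖q‖ < 1) (m : ℤ) :
    invPoch q (m - 1) = (1 - q ^ (2 * m)) * invPoch q m := by
  obtain hm | rfl | hm := lt_trichotomy m 0
  · rw [invPoch_of_neg q hm, invPoch_of_neg q (by omega), mul_zero]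
  · rw [invPoch_of_neg q (by omega)]
    simp
  · obtain ⟨n, rfl⟩ : ∃ n : ℕ, m = (n + 1 : ℕ) := ⟨(m - 1).toNat, by omega⟩
    have h2 : q ^ (2 * (n + 1 : ℕ) : ℤ) = q ^ (2 * n + 2) := by
      rw [← zpow_natCast]
      congr 1
    have h3 := one_sub_pow_ne_zero hq (n := 2 * n + 2) (by omega)
    rw [show ((n + 1 : ℕ) - 1 : ℤ) = n by simp, h2, invPoch_natCast, invPoch_natCast,
      Finset.prod_range_succ, mul_inv]
    field_simp

/-- The coefficient of `ζ ^ j` in `∏_{k ≤ N} (1 + q ^ (2 k - 1) ζ) (1 + q ^ (2 k - 1) ζ⁻¹)`. -/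
noncomputable def tripleCoeff (q : ℂ) (N : ℕ) (j : ℤ) : ℂ :=
  q ^ (j ^ 2) * (∏ k ∈ Finset.range (2 * N), (1 - q ^ (2 * k + 2)))
    * invPoch q (N - j) * invPoch q (N + j)

/-- This is the Pascal rule for the Gaussian binomials [2N, N + j] in base q². It matches
multiplication by 1 + q^(4N+2) + q^(2N+1) (ζ + ζ⁻¹), the factor of index N. -/
lemma tripleCoeff_succ {q : ℂ} (hq : ‖q‖ < 1) (hq0 : q ≠ 0) (N : ℕ) (j : ℤ) :
    tripleCoeff q (N + 1) j = (1 + q ^ (2 * N + 1) * q ^ (2 * N + 1)) * tripleCoeff q N j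
      + q ^ (2 * N + 1) * (tripleCoeff q N (j - 1) + tripleCoeff q N (j + 1)) := by
  have hj := zpow_ne_zero j hq0
  have e1 : invPoch q (N - j) = (1 - q ^ (2 * (N + 1 - j : ℤ))) * invPoch q (N + 1 - j) := by
    rw [← invPoch_sub_one hq]; ring_nf
  have e2 : invPoch q (N + j) = (1 - q ^ (2 * (N + 1 + j : ℤ))) * invPoch q (N + 1 + j) := by
    rw [← invPoch_sub_one hq]; ring_nf
  have e3 : invPoch q (N - (j + 1)) = (1 - q ^ (2 * (N - j : ℤ))) * invPoch q (N - j) := by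
    rw [← invPoch_sub_one hq]; ring_nf
  have e4 : invPoch q (N + (j - 1)) = (1 - q ^ (2 * (N + j : ℤ))) * invPoch q (N + j) := by
    rw [← invPoch_sub_one hq]; ring_nf
  have e5 : (N - (j - 1) : ℤ) = N + 1 - j := by ring
  have e6 : (N + (j + 1) : ℤ) = N + 1 + j := by ring
  have hw : ∀ k : ℤ, q ^ (2 * k) = (q ^ k) ^ 2 := fun k => by rw [mul_comm, zpow_mul]; norm_cast
  simp only [tripleCoeff, Nat.cast_add, Nat.cast_one, e3, e4, e5, e6, e1, e2,
    show 2 * (N + 1) = 2 * N + 1 + 1 by ring, Finset.prod_range_succ, hw,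
    show (j - 1) ^ 2 = j ^ 2 - 2 * j + 1 by ring, show (j + 1) ^ 2 = j ^ 2 + 2 * j + 1 by ring,
    zpow_add₀ hq0, zpow_sub₀ hq0, zpow_one, zpow_natCast]
  field_simp
  ring

lemma hasSum_tripleCoeff {q : ℂ} (hq : ‖q‖ < 1) (hq0 : q ≠ 0) {z : ℂ} (hz : z ≠ 0) (N : ℕ) :
    HasSum (fun j : ℤ => tripleCoeff q N j * z ^ j)
      (∏ k ∈ Finset.range N, (1 + q ^ (2 * k + 1) * z) * (1 + q ^ (2 * k + 1) * z⁻¹)) := by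
  induction N with
  | zero =>
    have h := hasSum_single (f := fun j : ℤ => tripleCoeff q 0 j * z ^ j) 0 fun j hj => by
      obtain hj | hj := hj.lt_or_gt
      · rw [tripleCoeff, invPoch_of_neg q (m := (0 : ℕ) + j) (by simpa using hj)]
        simp
      · rw [tripleCoeff, invPoch_of_neg q (m := (0 : ℕ) - j) (by simpa using hj)]
        simp
    simpa [tripleCoeff, invPoch_zero] using h
  | succ N ih =>
    have h1 := ((Equiv.subRight (1 : ℤ)).hasSum_iff.mpr ih).mul_left (q ^ (2 * N + 1) * z)
    have h2 := ((Equiv.addRight (1 : ℤ)).hasSum_iff.mpr ih).mul_left (q ^ (2 * N + 1) * z⁻¹)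
    have h := (ih.mul_left (1 + q ^ (2 * N + 1) * q ^ (2 * N + 1))).add (h1.add h2)
    rw [Finset.prod_range_succ]
    convert! h using 1
    · ext j
      simp only [Function.comp_apply, Equiv.coe_addRight, Equiv.subRight_apply,
        tripleCoeff_succ hq hq0, zpow_sub₀ hz, zpow_add₀ hz, zpow_one]
      field_simp
    · linear_combination
        (∏ k ∈ Finset.range N, (1 + q ^ (2 * k + 1) * z) * (1 + q ^ (2 * k + 1) * z⁻¹)) *
          q ^ (2 * N + 1) * q ^ (2 * N + 1) * mul_inv_cancel₀ hz

/-! ### Convergence and the limit of the triple product -/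

lemma summable_pow_linear {q : ℂ} (hq : ‖q‖ < 1) {a : ℕ} (ha : a ≠ 0) (b : ℕ) :
    Summable fun n : ℕ => ‖q ^ (a * n + b)‖ := by
  have h : ‖q ^ a‖ < 1 := by
    rw [norm_pow]
    exact pow_lt_one₀ (norm_nonneg _) hq ha
  refine ((summable_geometric_of_lt_one (norm_nonneg _) h).mul_right (‖q ^ b‖)).congr fun n => ?_
  rw [pow_add, pow_mul, norm_mul, norm_pow (q ^ a)]

lemma multipliable_one_add_pow_mul {q : ℂ} (hq : ‖q‖ < 1) {a : ℕ} (ha : a ≠ 0) (b : ℕ) (c : ℂ) :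
    Multipliable fun n : ℕ => 1 + q ^ (a * n + b) * c :=
  multipliable_one_add_of_summable <| by
    simpa [norm_mul] using (summable_pow_linear hq ha b).mul_right ‖c‖

lemma multipliable_one_add_pow_linear {q : ℂ} (hq : ‖q‖ < 1) {a : ℕ} (ha : a ≠ 0) (b : ℕ) :
    Multipliable fun n : ℕ => 1 + q ^ (a * n + b) := by
  simpa using multipliable_one_add_pow_mul hq ha b 1

lemma multipliable_one_sub_pow_linear {q : ℂ} (hq : ‖q‖ < 1) {a : ℕ} (ha : a ≠ 0) (b : ℕ) :
    Multipliable fun n : ℕ => 1 - q ^ (a * n + b) := by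
  simpa [sub_eq_add_neg] using multipliable_one_add_pow_mul hq ha b (-1)

lemma tprod_one_sub_pow_even_ne_zero {q : ℂ} (hq : ‖q‖ < 1) :
    ∏' n : ℕ, (1 - q ^ (2 * n + 2)) ≠ 0 := by
  simp only [sub_eq_add_neg]
  refine tprod_one_add_ne_zero_of_summable (fun n => ?_) ?_
  · simpa [sub_eq_add_neg] using one_sub_pow_ne_zero hq (n := 2 * n + 2) (by omega)
  · simpa using summable_pow_linear hq two_ne_zero 2

lemma tendsto_prod_one_sub_pow_even {q : ℂ} (hq : ‖q‖ < 1) :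
    Tendsto (fun N : ℕ => ∏ k ∈ Finset.range N, (1 - q ^ (2 * k + 2))) atTop
      (𝓝 (∏' n : ℕ, (1 - q ^ (2 * n + 2)))) :=
  (multipliable_one_sub_pow_linear hq two_ne_zero 2).hasProd.tendsto_prod_nat

lemma tendsto_invPoch {q : ℂ} (hq : ‖q‖ < 1) :
    Tendsto (invPoch q) atTop (𝓝 (∏' n : ℕ, (1 - q ^ (2 * n + 2)))⁻¹) := by
  have h := (tendsto_prod_one_sub_pow_even hq).inv₀ (tprod_one_sub_pow_even_ne_zero hq)
  rw [← Nat.map_cast_int_atTop, tendsto_map'_iff]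
  exact h

lemma exists_norm_invPoch_le {q : ℂ} (hq : ‖q‖ < 1) : ∃ C, ∀ m, ‖invPoch q m‖ ≤ C := by
  have h := (tendsto_prod_one_sub_pow_even hq).inv₀ (tprod_one_sub_pow_even_ne_zero hq)
  obtain ⟨C, hC⟩ := (Metric.isBounded_range_of_tendsto _ h).exists_norm_le
  refine ⟨C, fun m => ?_⟩
  obtain n | n := m
  · exact hC _ ⟨n, rfl⟩
  · simpa [invPoch] using (norm_nonneg _).trans (hC _ ⟨0, rfl⟩)

/-- The **Jacobi triple product** identity, in terms of `q` and `z`. -/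
lemma tsum_pow_sq_mul_zpow {q : ℂ} (hq : ‖q‖ < 1) (hq0 : q ≠ 0) {z : ℂ} (hz : z ≠ 0)
    (hs : Summable fun j : ℤ => ‖q ^ (j ^ 2) * z ^ j‖) :
    ∑' j : ℤ, q ^ (j ^ 2) * z ^ j = (∏' n : ℕ, (1 - q ^ (2 * n + 2))) *
      ((∏' n : ℕ, (1 + q ^ (2 * n + 1) * z)) * ∏' n : ℕ, (1 + q ^ (2 * n + 1) * z⁻¹)) := by
  set E := ∏' n : ℕ, (1 - q ^ (2 * n + 2)) with hE
  have hE0 : E ≠ 0 := tprod_one_sub_pow_even_ne_zero hq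
  have hP := tendsto_prod_one_sub_pow_even hq
  have h2N : Tendsto (fun N : ℕ => 2 * N) atTop atTop :=
    tendsto_id.const_mul_atTop' two_pos
  obtain ⟨C, hC⟩ := exists_norm_invPoch_le hq
  obtain ⟨K, hK⟩ := (Metric.isBounded_range_of_tendsto _ hP).exists_norm_le
  have hC0 : 0 ≤ C := (norm_nonneg _).trans (hC 0)
  have hK0 : 0 ≤ K := (norm_nonneg _).trans (hK _ ⟨0, rfl⟩)
  -- Tannery's theorem: for fixed j the coefficient tends to q^(j²) E E⁻¹ E⁻¹, and uniform bounds on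
  -- the finite products and their reciprocals give the dominating series.
  have hlim : Tendsto (fun N : ℕ => ∑' j : ℤ, tripleCoeff q N j * z ^ j) atTop
      (𝓝 (∑' j : ℤ, q ^ (j ^ 2) * z ^ j * E⁻¹)) := by
    refine tendsto_tsum_of_dominated_convergence
      (bound := fun j : ℤ => ‖q ^ (j ^ 2) * z ^ j‖ * (K * C * C)) (hs.mul_right _) (fun j => ?_)
      (.of_forall fun N j => ?_)
    · have h1 : Tendsto (fun N : ℕ => invPoch q (N - j)) atTop (𝓝 E⁻¹) :=
        (tendsto_invPoch hq).comp
          (tendsto_atTop_add_const_right _ (-j) tendsto_natCast_atTop_atTop)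
      have h2 : Tendsto (fun N : ℕ => invPoch q (N + j)) atTop (𝓝 E⁻¹) :=
        (tendsto_invPoch hq).comp
          (tendsto_atTop_add_const_right _ j tendsto_natCast_atTop_atTop)
      have h := ((((hP.comp h2N).const_mul (q ^ (j ^ 2))).mul h1).mul h2).mul_const (z ^ j)
      convert h using 2
      · rfl
      · rw [← hE]
        field_simp
    · have h1 := hK _ ⟨2 * N, rfl⟩
      have h2 := hC (N - j)
      have h3 := hC (N + j)
      calc ‖tripleCoeff q N j * z ^ j‖
          = ‖q ^ (j ^ 2) * z ^ j‖ * (‖∏ k ∈ Finset.range (2 * N), (1 - q ^ (2 * k + 2))‖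
            * ‖invPoch q (N - j)‖ * ‖invPoch q (N + j)‖) := by
            simp only [tripleCoeff, norm_mul]; ring
        _ ≤ _ := by gcongr
  have hprod : Tendsto (fun N : ℕ => ∑' j : ℤ, tripleCoeff q N j * z ^ j) atTop
      (𝓝 ((∏' n : ℕ, (1 + q ^ (2 * n + 1) * z)) * ∏' n : ℕ, (1 + q ^ (2 * n + 1) * z⁻¹))) := by
    simp only [(hasSum_tripleCoeff hq hq0 hz _).tsum_eq, Finset.prod_mul_distrib]
    exact (multipliable_one_add_pow_mul hq two_ne_zero 1 z).hasProd.tendsto_prod_nat.mul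
      (multipliable_one_add_pow_mul hq two_ne_zero 1 z⁻¹).hasProd.tendsto_prod_nat
  rw [← tendsto_nhds_unique hlim hprod, tsum_mul_right]
  field_simp

lemma norm_cexp_pi_mul_I_lt_one {τ : ℂ} (hτ : 0 < τ.im) : ‖cexp (Real.pi * I * τ)‖ < 1 := by
  rw [Complex.norm_exp, Real.exp_lt_one_iff]
  have : (Real.pi * I * τ : ℂ).re = -(Real.pi * τ.im) := by simp
  rw [this, neg_lt_zero]
  positivity

/-- The **Jacobi triple product** identity for the two-variable theta function. -/
theorem jacobiTheta₂_eq_tprod (z : ℂ) {τ : ℂ} (hτ : 0 < τ.im) :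
    jacobiTheta₂ z τ = (∏' n : ℕ, (1 - cexp (Real.pi * I * τ) ^ (2 * n + 2))) *
      ((∏' n : ℕ, (1 + cexp (Real.pi * I * τ) ^ (2 * n + 1) * cexp (2 * Real.pi * I * z))) *
        ∏' n : ℕ, (1 + cexp (Real.pi * I * τ) ^ (2 * n + 1) * (cexp (2 * Real.pi * I * z))⁻¹)) := by
  have hterm (j : ℤ) : jacobiTheta₂_term j z τ =
      cexp (Real.pi * I * τ) ^ (j ^ 2) * cexp (2 * Real.pi * I * z) ^ j := by
    rw [jacobiTheta₂_term, ← Complex.exp_int_mul, ← Complex.exp_int_mul, ← Complex.exp_add]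
    congr 1
    push_cast
    ring
  have hs := ((summable_jacobiTheta₂_term_iff z τ).mpr hτ).norm
  simp only [jacobiTheta₂, hterm] at hs ⊢
  exact tsum_pow_sq_mul_zpow (norm_cexp_pi_mul_I_lt_one hτ) (Complex.exp_ne_zero _)
    (Complex.exp_ne_zero _) hs

/-! ### The addition formula -/

/-- The pairs of integers with even sum and those with odd sum, both parametrized by `ℤ × ℤ`. -/
def parityMap : (ℤ × ℤ) ⊕ (ℤ × ℤ) → ℤ × ℤ
  | .inl p => (p.1 + p.2, p.1 - p.2)
  | .inr p => (p.1 + p.2 + 1, p.1 - p.2)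

lemma parityMap_bijective : Function.Bijective parityMap := by
  constructor
  · rintro (⟨a, b⟩ | ⟨a, b⟩) (⟨c, d⟩ | ⟨c, d⟩) h <;> simp [parityMap] at h ⊢ <;> omega
  · rintro ⟨m, n⟩
    obtain ⟨k, hk⟩ | ⟨k, hk⟩ := Int.even_or_odd (m + n)
    · exact ⟨.inl (k, m - k), by ext <;> simp [parityMap]; omega⟩
    · exact ⟨.inr (k, m - k - 1), by ext <;> simp [parityMap] <;> omega⟩

/-- The addition formula expressing a product of two theta functions at `τ` by theta functions at
`2 τ`. -/
theorem jacobiTheta₂_mul_jacobiTheta₂ (x y : ℂ) {τ : ℂ} (hτ : 0 < τ.im) :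
    jacobiTheta₂ x τ * jacobiTheta₂ y τ =
      jacobiTheta₂ (x + y) (2 * τ) * jacobiTheta₂ (x - y) (2 * τ) +
      cexp (2 * Real.pi * I * x + Real.pi * I * τ) *
        (jacobiTheta₂ (x + y + τ) (2 * τ) * jacobiTheta₂ (x - y + τ) (2 * τ)) := by
  have hτ2 : 0 < (2 * τ).im := by simpa using hτ
  have key (u v : ℂ) {σ : ℂ} (hσ : 0 < σ.im) :
      HasSum (fun p : ℤ × ℤ => jacobiTheta₂_term p.1 u σ * jacobiTheta₂_term p.2 v σ)
        (jacobiTheta₂ u σ * jacobiTheta₂ v σ) := by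
    have hu := ((summable_jacobiTheta₂_term_iff u σ).mpr hσ).norm
    have hv := ((summable_jacobiTheta₂_term_iff v σ).mpr hσ).norm
    rw [jacobiTheta₂, jacobiTheta₂, tsum_mul_tsum_of_summable_norm hu hv]
    exact (summable_mul_of_summable_norm hu hv).hasSum
  -- The change of variables diagonalizes the form: m² + n² is 2(a² + b²) on the even class and 2(a²
  -- + b²) + 2(a + b) + 1 on the odd one. The linear term shifts both arguments by τ and the
  -- constant gives the factor exp(πiτ).
  have h1 := (Equiv.ofBijective _ parityMap_bijective).hasSum_iff.mpr (key x y hτ)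
  refine h1.unique (HasSum.sum (f := (fun p : ℤ × ℤ =>
    jacobiTheta₂_term p.1 x τ * jacobiTheta₂_term p.2 y τ) ∘ parityMap) ?_ ?_)
  · refine (key (x + y) (x - y) hτ2).congr_fun fun p => ?_
    simp only [Function.comp_apply, parityMap, jacobiTheta₂_term, ← Complex.exp_add]
    congr 1
    push_cast
    ring
  · refine ((key (x + y + τ) (x - y + τ) hτ2).mul_left
      (cexp (2 * Real.pi * I * x + Real.pi * I * τ))).congr_fun fun p => ?_
    simp only [Function.comp_apply, parityMap, jacobiTheta₂_term, ← Complex.exp_add]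
    congr 1
    push_cast
    ring

/-! ### Euler-type product identities -/

/-- The product `∏_{n ≥ 1} (1 + q ^ (2 n - 1))`. -/
noncomputable def oddAdd (q : ℂ) : ℂ := ∏' n : ℕ, (1 + q ^ (2 * n + 1))

/-- The product `∏_{n ≥ 1} (1 - q ^ (2 n - 1))`. -/
noncomputable def oddSub (q : ℂ) : ℂ := ∏' n : ℕ, (1 - q ^ (2 * n + 1))

/-- The product `∏_{n ≥ 1} (1 + q ^ (2 n))`. -/
noncomputable def evenAdd (q : ℂ) : ℂ := ∏' n : ℕ, (1 + q ^ (2 * n + 2))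

/-- The product `∏_{n ≥ 1} (1 - q ^ (2 n))`. -/
noncomputable def evenSub (q : ℂ) : ℂ := ∏' n : ℕ, (1 - q ^ (2 * n + 2))

lemma evenSub_ne_zero {q : ℂ} (hq : ‖q‖ < 1) : evenSub q ≠ 0 :=
  tprod_one_sub_pow_even_ne_zero hq

lemma tprod_one_sub_pow_succ {q : ℂ} (hq : ‖q‖ < 1) :
    ∏' n : ℕ, (1 - q ^ (n + 1)) = oddSub q * evenSub q :=
  (tprod_even_mul_odd (f := fun n : ℕ => 1 - q ^ (n + 1))
    (multipliable_one_sub_pow_linear hq two_ne_zero 1)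
    (multipliable_one_sub_pow_linear hq two_ne_zero 2)).symm

lemma tprod_one_add_pow_succ {q : ℂ} (hq : ‖q‖ < 1) :
    ∏' n : ℕ, (1 + q ^ (n + 1)) = oddAdd q * evenAdd q :=
  (tprod_even_mul_odd (f := fun n : ℕ => 1 + q ^ (n + 1))
    (multipliable_one_add_pow_linear hq two_ne_zero 1)
    (multipliable_one_add_pow_linear hq two_ne_zero 2)).symm

/-- Euler's identity `∏ (1 + q ^ n) ∏ (1 - q ^ (2 n - 1)) = 1`. -/
lemma oddAdd_mul_evenAdd_mul_oddSub {q : ℂ} (hq : ‖q‖ < 1) :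
    oddAdd q * evenAdd q * oddSub q = 1 := by
  have h : (∏' n : ℕ, (1 - q ^ (n + 1))) * ∏' n : ℕ, (1 + q ^ (n + 1)) = evenSub q := by
    have hs := multipliable_one_sub_pow_linear hq one_ne_zero 1
    have ha := multipliable_one_add_pow_linear hq one_ne_zero 1
    simp only [one_mul] at hs ha
    rw [← hs.tprod_mul ha, evenSub]
    exact tprod_congr fun n => by ring
  rw [tprod_one_sub_pow_succ hq, tprod_one_add_pow_succ hq] at h
  refine mul_left_cancel₀ (evenSub_ne_zero hq) ?_
  linear_combination h

lemma evenSub_eq_sq {q : ℂ} (hq : ‖q‖ < 1) : evenSub q = oddSub (q ^ 2) * evenSub (q ^ 2) := by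
  have hq2 : ‖q ^ 2‖ < 1 := by
    rw [norm_pow]
    exact pow_lt_one₀ (norm_nonneg _) hq two_ne_zero
  rw [← tprod_one_sub_pow_succ hq2, evenSub]
  exact tprod_congr fun n => by ring

lemma oddAdd_mul_oddSub {q : ℂ} (hq : ‖q‖ < 1) : oddAdd q * oddSub q = oddSub (q ^ 2) := by
  rw [oddAdd, oddSub, ← (multipliable_one_add_pow_linear hq two_ne_zero 1).tprod_mul
    (multipliable_one_sub_pow_linear hq two_ne_zero 1), oddSub]
  exact tprod_congr fun n => by ring

/-! ### Product forms of the theta constants and of eta -/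

lemma qpow_add (a b τ : ℂ) : qpow (a + b) τ = qpow a τ * qpow b τ := by
  rw [qpow, qpow, qpow, ← Complex.exp_add]
  congr 1
  ring

lemma qpow_pow (a τ : ℂ) (n : ℕ) : qpow a τ ^ n = qpow (n * a) τ := by
  rw [qpow, qpow, ← Complex.exp_nat_mul]
  congr 1
  ring

lemma qpow_ne_zero (a τ : ℂ) : qpow a τ ≠ 0 := Complex.exp_ne_zero _

lemma qpow_one_eq (τ : ℂ) : qpow 1 τ = cexp (Real.pi * I * (2 * τ)) := by
  rw [qpow]
  congr 1
  ring

lemma norm_qpow_one_lt_one {τ : ℂ} (hτ : 0 < τ.im) : ‖qpow 1 τ‖ < 1 := by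
  rw [qpow_one_eq]
  exact norm_cexp_pi_mul_I_lt_one (by simpa using hτ)

lemma jacobiTheta₂_zero_eq {τ : ℂ} (hτ : 0 < τ.im) :
    jacobiTheta₂ 0 (2 * τ) = evenSub (qpow 1 τ) * oddAdd (qpow 1 τ) ^ 2 := by
  rw [jacobiTheta₂_eq_tprod 0 (τ := 2 * τ) (by simpa using hτ), ← qpow_one_eq]
  simp [evenSub, oddAdd, sq]

lemma jacobiTheta₂_half_eq {τ : ℂ} (hτ : 0 < τ.im) :
    jacobiTheta₂ (1 / 2) (2 * τ) = evenSub (qpow 1 τ) * oddSub (qpow 1 τ) ^ 2 := by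
  rw [jacobiTheta₂_eq_tprod (1 / 2) (τ := 2 * τ) (by simpa using hτ), ← qpow_one_eq,
    show 2 * (Real.pi : ℂ) * I * (1 / 2) = Real.pi * I by ring, Complex.exp_pi_mul_I]
  simp [evenSub, oddSub, sq, sub_eq_add_neg, inv_neg]

lemma jacobiTheta₂_self_eq {τ : ℂ} (hτ : 0 < τ.im) :
    jacobiTheta₂ τ (2 * τ) = 2 * evenSub (qpow 1 τ) * evenAdd (qpow 1 τ) ^ 2 := by
  have hq := norm_qpow_one_lt_one hτ
  have hq0 := qpow_ne_zero 1 τ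
  -- Here z⁻¹ becomes q⁻¹, so the factor at n = 0 is 1 + 1, the source of the 2 in θ₂.
  have h0 : ∏' n : ℕ, (1 + qpow 1 τ ^ (2 * n + 1) * (qpow 1 τ)⁻¹) = 2 * evenAdd (qpow 1 τ) := by
    have hm : Multipliable fun n : ℕ => 1 + qpow 1 τ ^ (2 * (n + 1)) := by
      simpa only [mul_add, mul_one] using multipliable_one_add_pow_linear hq two_ne_zero 2
    have hsplit := tprod_eq_zero_mul' (f := fun n : ℕ => 1 + qpow 1 τ ^ (2 * n)) hm
    simp only [mul_zero, pow_zero, one_add_one_eq_two, mul_add, mul_one] at hsplit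
    rw [evenAdd, ← hsplit]
    exact tprod_congr fun n => by rw [pow_succ, mul_assoc, mul_inv_cancel₀ hq0, mul_one]
  rw [jacobiTheta₂_eq_tprod τ (τ := 2 * τ) (by simpa using hτ), ← qpow_one_eq,
    show 2 * (Real.pi : ℂ) * I * τ = Real.pi * I * (2 * τ) by ring, ← qpow_one_eq, h0]
  simp only [← pow_succ]
  change evenSub (qpow 1 τ) * (evenAdd (qpow 1 τ) * _) = _
  ring

lemma eta_eq {τ : ℂ} (hτ : 0 < τ.im) :
    ModularForm.eta τ = qpow (1 / 24) τ * (oddSub (qpow 1 τ) * evenSub (qpow 1 τ)) := by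
  rw [← tprod_one_sub_pow_succ (norm_qpow_one_lt_one hτ), ModularForm.eta,
    Function.Periodic.qParam, qpow]
  congr 1
  · congr 1
    push_cast
    ring
  · exact tprod_congr fun n => by rw [ModularForm.eta_q_eq_pow, qpow, mul_one]

lemma eta_two_mul_eq {τ : ℂ} (hτ : 0 < τ.im) :
    ModularForm.eta (2 * τ) = qpow (1 / 12) τ * evenSub (qpow 1 τ) := by
  have h2 : qpow 1 (2 * τ) = qpow 1 τ ^ 2 := by
    rw [qpow_pow, qpow, qpow]
    congr 1
    push_cast
    ring
  rw [eta_eq (τ := 2 * τ) (by simpa using hτ), h2, ← evenSub_eq_sq (norm_qpow_one_lt_one hτ)]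
  congr 1
  rw [qpow, qpow]
  congr 1
  ring

lemma hasSum_qpow_sq {τ : ℂ} (hτ : 0 < τ.im) :
    HasSum (fun n : ℤ => qpow ((n : ℂ) ^ 2) τ) (jacobiTheta₂ 0 (2 * τ)) := by
  refine (hasSum_jacobiTheta₂_term 0 (τ := 2 * τ) (by simpa using hτ)).congr_fun fun n => ?_
  rw [qpow, jacobiTheta₂_term]
  congr 1
  ring

/-- Expanding (n + 1/2)² = n² + n + 1/4, the linear term is the theta argument τ. -/
lemma hasSum_qpow_add_half_sq {τ : ℂ} (hτ : 0 < τ.im) :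
    HasSum (fun n : ℤ => qpow (((n : ℂ) + 1 / 2) ^ 2) τ)
      (qpow (1 / 4) τ * jacobiTheta₂ τ (2 * τ)) := by
  refine ((hasSum_jacobiTheta₂_term τ (τ := 2 * τ) (by simpa using hτ)).mul_left
    (qpow (1 / 4) τ)).congr_fun fun n => ?_
  rw [qpow, qpow, jacobiTheta₂_term, ← Complex.exp_add]
  congr 1
  ring

lemma f₁_eq {τ : ℂ} (hτ : 0 < τ.im) :
    f₁ τ = evenSub (qpow 1 τ) * oddAdd (qpow 1 τ) ^ 2 / ModularForm.eta τ := by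
  rw [f₁, (hasSum_qpow_sq hτ).tsum_eq, jacobiTheta₂_zero_eq hτ]

lemma f₂_eq {τ : ℂ} (hτ : 0 < τ.im) :
    f₂ τ = qpow (1 / 4) τ * (2 * evenSub (qpow 1 τ) * evenAdd (qpow 1 τ) ^ 2)
      / ModularForm.eta τ := by
  rw [f₂, (hasSum_qpow_add_half_sq hτ).tsum_eq, jacobiTheta₂_self_eq hτ]

/-! ### Duplication formulas and the Weber identity -/

/-- The duplication formula `θ₃(q)² - θ₂(q)² = θ₄(r)²`, where `r ^ 2 = q`. -/
lemma theta_sq_sub_theta_sq {τ : ℂ} (hτ : 0 < τ.im) :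
    (evenSub (qpow 1 τ) * oddAdd (qpow 1 τ) ^ 2) ^ 2
      - (qpow (1 / 4) τ * (2 * evenSub (qpow 1 τ) * evenAdd (qpow 1 τ) ^ 2)) ^ 2
      = (evenSub (qpow 1 (τ / 2)) * oddSub (qpow 1 (τ / 2)) ^ 2) ^ 2 := by
  have h := jacobiTheta₂_mul_jacobiTheta₂ (1 / 2) (1 / 2) hτ
  -- At x = y = 1/2 the factor exp(πi) = -1 gives the minus sign; exp(πiτ) is the square of q^(1/4).
  have hexp : cexp (2 * Real.pi * I * (1 / 2) + Real.pi * I * τ) = - qpow (1 / 4) τ ^ 2 := by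
    rw [Complex.exp_add, show 2 * (Real.pi : ℂ) * I * (1 / 2) = Real.pi * I by ring,
      Complex.exp_pi_mul_I, qpow_pow, qpow, neg_one_mul]
    congr 2
    push_cast
    ring
  have hθ : jacobiTheta₂ (1 / 2) τ = jacobiTheta₂ (1 / 2) (2 * (τ / 2)) := by congr 1; ring
  have h1 : jacobiTheta₂ (1 / 2 + 1 / 2) (2 * τ) = jacobiTheta₂ 0 (2 * τ) := by
    rw [← jacobiTheta₂_add_left 0]; congr 1; norm_num
  have h2 : jacobiTheta₂ (1 / 2 + 1 / 2 + τ) (2 * τ) = jacobiTheta₂ τ (2 * τ) := by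
    rw [← jacobiTheta₂_add_left τ]; congr 1; ring
  rw [h1, h2, hexp, hθ, sub_self, zero_add, jacobiTheta₂_zero_eq hτ, jacobiTheta₂_self_eq hτ,
    jacobiTheta₂_half_eq (τ := τ / 2) (by simpa using hτ)] at h
  linear_combination -h

/-- The duplication formula `θ₃(q)² + θ₂(q)² = θ₃(r)²`, where `r ^ 2 = q`. -/
lemma theta_sq_add_theta_sq {τ : ℂ} (hτ : 0 < τ.im) :
    (evenSub (qpow 1 τ) * oddAdd (qpow 1 τ) ^ 2) ^ 2
      + (qpow (1 / 4) τ * (2 * evenSub (qpow 1 τ) * evenAdd (qpow 1 τ) ^ 2)) ^ 2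
      = (evenSub (qpow 1 (τ / 2)) * oddAdd (qpow 1 (τ / 2)) ^ 2) ^ 2 := by
  have h := jacobiTheta₂_mul_jacobiTheta₂ 0 0 hτ
  have hexp : cexp (2 * Real.pi * I * 0 + Real.pi * I * τ) = qpow (1 / 4) τ ^ 2 := by
    rw [qpow_pow, qpow]
    congr 1
    push_cast
    ring
  have hθ : jacobiTheta₂ 0 τ = jacobiTheta₂ 0 (2 * (τ / 2)) := by congr 1; ring
  rw [hexp, hθ, sub_self, add_zero, zero_add, jacobiTheta₂_zero_eq hτ, jacobiTheta₂_self_eq hτ,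
    jacobiTheta₂_zero_eq (τ := τ / 2) (by simpa using hτ)] at h
  linear_combination -h

lemma qpow_one_half_sq (τ : ℂ) : qpow 1 (τ / 2) ^ 2 = qpow 1 τ := by
  rw [qpow_pow, qpow, qpow]
  congr 1
  push_cast
  ring

lemma weberIdentity_iff {q : ℂ} (hq : ‖q‖ < 1) :
    WeberIdentity q ↔ oddAdd q ^ 8 - 16 * q * evenAdd q ^ 8 = oddSub q ^ 8 := by
  rw [WeberIdentity, (multipliable_one_add_pow_linear hq two_ne_zero 1).tprod_pow 8,
    (multipliable_one_add_pow_linear hq two_ne_zero 2).tprod_pow 8,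
    (multipliable_one_sub_pow_linear hq two_ne_zero 1).tprod_pow 8]
  rfl

/-- Jacobi's identity `θ₃⁴ - θ₂⁴ = θ₄⁴`, in product form. -/
lemma weberIdentity_qpow_one {τ : ℂ} (hτ : 0 < τ.im) : WeberIdentity (qpow 1 τ) := by
  have hq := norm_qpow_one_lt_one hτ
  have hτ2 : 0 < (τ / 2).im := by simpa using hτ
  have hr := norm_qpow_one_lt_one hτ2
  have hE := evenSub_eq_sq hr
  have hAB := oddAdd_mul_oddSub hr
  rw [qpow_one_half_sq] at hE hAB
  -- This is θ₄(r)² θ₃(r)² = θ₄(q)⁴: passing from r to q gives E(r) = B(q) E(q) and A(r) B(r) =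
  -- B(q).
  have hprod : (evenSub (qpow 1 (τ / 2)) * oddSub (qpow 1 (τ / 2)) ^ 2) ^ 2 *
      (evenSub (qpow 1 (τ / 2)) * oddAdd (qpow 1 (τ / 2)) ^ 2) ^ 2 =
      evenSub (qpow 1 τ) ^ 4 * oddSub (qpow 1 τ) ^ 8 := by
    rw [show ∀ e a b : ℂ, (e * b ^ 2) ^ 2 * (e * a ^ 2) ^ 2 = e ^ 4 * (a * b) ^ 4 by intros; ring,
      hE, hAB]
    ring
  rw [← theta_sq_sub_theta_sq hτ, ← theta_sq_add_theta_sq hτ] at hprod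
  have hq4 : qpow (1 / 4) τ ^ 4 = qpow 1 τ := by rw [qpow_pow]; norm_num
  rw [weberIdentity_iff hq]
  refine mul_left_cancel₀ (pow_ne_zero 4 (evenSub_ne_zero hq)) ?_
  linear_combination hprod + 16 * evenSub (qpow 1 τ) ^ 4 * evenAdd (qpow 1 τ) ^ 8 * hq4

end ThetaWeber

theorem proposition4p3 (τ : ℂ) (hτ : 0 < τ.im) :
    -- the series and products converge and no denominator vanishes
    (Summable (fun n : ℤ => ThetaWeber.qpow ((n : ℂ) ^ 2) τ) ∧
      Summable (fun n : ℤ => ThetaWeber.qpow (((n : ℂ) + 1 / 2) ^ 2) τ) ∧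
      Multipliable (fun n : ℕ => (1 + ThetaWeber.qpow 1 τ ^ (2 * n + 1)) ^ 8) ∧
      Multipliable (fun n : ℕ => (1 + ThetaWeber.qpow 1 τ ^ (2 * n + 2)) ^ 8) ∧
      Multipliable (fun n : ℕ => (1 - ThetaWeber.qpow 1 τ ^ (2 * n + 1)) ^ 8) ∧
      ModularForm.eta τ ≠ 0 ∧ ModularForm.eta (2 * τ) ≠ 0 ∧
      ThetaWeber.f₁ τ ≠ 0 ∧ ThetaWeber.f₂ τ ≠ 0) ∧
    -- the first identity
    2 * (ThetaWeber.f₁ τ / ThetaWeber.f₂ τ) - 2 * (ThetaWeber.f₂ τ / ThetaWeber.f₁ τ)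
      = (ModularForm.eta (τ / 2) / ModularForm.eta (2 * τ)) ^ 4 ∧
    -- the second identity
    ThetaWeber.f₁ τ ^ 5 * ThetaWeber.f₂ τ - ThetaWeber.f₂ τ ^ 5 * ThetaWeber.f₁ τ = 2 ∧
    -- the second identity is equivalent to the Weber identity, at every point
    (ThetaWeber.f₁ τ ^ 5 * ThetaWeber.f₂ τ - ThetaWeber.f₂ τ ^ 5 * ThetaWeber.f₁ τ = 2 ↔
      ThetaWeber.WeberIdentity (ThetaWeber.qpow 1 τ)) ∧
    -- the Weber identity
    ThetaWeber.WeberIdentity (ThetaWeber.qpow 1 τ) := by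
  open ThetaWeber in
  have hτh : 0 < (τ / 2).im := by simpa using hτ
  have hτd : 0 < (2 * τ).im := by simpa using hτ
  have hq := norm_qpow_one_lt_one hτ
  have hr := norm_qpow_one_lt_one hτh
  have hη := ModularForm.eta_ne_zero (z := τ) hτ
  have hη2 := ModularForm.eta_ne_zero (z := 2 * τ) hτd
  have hE := evenSub_ne_zero hq
  have hABC := oddAdd_mul_evenAdd_mul_oddSub hq
  have hA : oddAdd (qpow 1 τ) ≠ 0 := by rintro h; simp [h] at hABC
  have hB : oddSub (qpow 1 τ) ≠ 0 := by rintro h; simp [h] at hABC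
  have hC : evenAdd (qpow 1 τ) ≠ 0 := by rintro h; simp [h] at hABC
  have h4 := qpow_ne_zero (1 / 4) τ
  have h24 := qpow_ne_zero (1 / 24) τ
  have h12 := qpow_ne_zero (1 / 12) τ
  have hf₁ : f₁ τ ≠ 0 := by
    rw [f₁_eq hτ]
    exact div_ne_zero (mul_ne_zero hE (pow_ne_zero 2 hA)) hη
  have hf₂ : f₂ τ ≠ 0 := by
    rw [f₂_eq hτ]
    exact div_ne_zero (mul_ne_zero h4 (mul_ne_zero (mul_ne_zero two_ne_zero hE)
      (pow_ne_zero 2 hC))) hη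
  have hiff : f₁ τ ^ 5 * f₂ τ - f₂ τ ^ 5 * f₁ τ = 2 ↔ WeberIdentity (qpow 1 τ) := by
    have hq4 : qpow (1 / 4) τ ^ 4 = qpow 1 τ := by rw [qpow_pow]; norm_num
    have hq24 : qpow (1 / 24) τ ^ 6 = qpow (1 / 4) τ := by rw [qpow_pow]; norm_num
    -- All factors E cancel, and six factors q^(1/24) from η cancel q^(1/4). The factor (A C B)² is
    -- split off so that Euler's identity removes it.
    have key : f₁ τ ^ 5 * f₂ τ - f₂ τ ^ 5 * f₁ τ =
        2 * ((oddAdd (qpow 1 τ) ^ 8 - 16 * qpow 1 τ * evenAdd (qpow 1 τ) ^ 8)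
          / oddSub (qpow 1 τ) ^ 8 *
            (oddAdd (qpow 1 τ) * evenAdd (qpow 1 τ) * oddSub (qpow 1 τ)) ^ 2) := by
      rw [f₁_eq hτ, f₂_eq hτ, eta_eq hτ]
      generalize evenSub (qpow 1 τ) = E at hE ⊢
      generalize oddSub (qpow 1 τ) = B at hB ⊢
      generalize oddAdd (qpow 1 τ) = A
      generalize evenAdd (qpow 1 τ) = C
      rw [← hq4, ← hq24]
      field_simp
      ring
    rw [key, hABC, one_pow, mul_one, weberIdentity_iff hq, mul_eq_left₀ two_ne_zero,
      div_eq_one_iff_eq (pow_ne_zero 8 hB)]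
  have hW := weberIdentity_qpow_one hτ
  refine ⟨⟨(hasSum_qpow_sq hτ).summable, (hasSum_qpow_add_half_sq hτ).summable,
    (multipliable_one_add_pow_linear hq two_ne_zero 1).pow 8,
    (multipliable_one_add_pow_linear hq two_ne_zero 2).pow 8,
    (multipliable_one_sub_pow_linear hq two_ne_zero 1).pow 8, hη, hη2, hf₁, hf₂⟩,
    ?_, hiff.mpr hW, hiff, hW⟩
  have hsub := theta_sq_sub_theta_sq hτ
  have hEr := evenSub_eq_sq hr
  rw [qpow_one_half_sq] at hEr
  -- Exponents of q: 4/12 = 1/4 + (1/2)(4/24).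
  have hq12 : qpow (1 / 12) τ ^ 4 = qpow (1 / 4) τ * qpow (1 / 24) (τ / 2) ^ 4 := by
    rw [qpow_pow, qpow_pow, qpow, qpow, qpow, ← Complex.exp_add]
    congr 1
    push_cast
    ring
  rw [eta_eq hτh, eta_two_mul_eq hτ, div_pow, eq_div_iff (by positivity), mul_pow (qpow (1 / 12) τ),
    hq12]
  have hratio : 2 * (f₁ τ / f₂ τ) - 2 * (f₂ τ / f₁ τ) =
      (evenSub (qpow 1 (τ / 2)) * oddSub (qpow 1 (τ / 2)) ^ 2) ^ 2 /
        (qpow (1 / 4) τ * evenSub (qpow 1 τ) ^ 2 *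
          (oddAdd (qpow 1 τ) * evenAdd (qpow 1 τ)) ^ 2) := by
    rw [← hsub, f₁_eq hτ, f₂_eq hτ]
    field_simp
  -- Replacing A C by 1/B and E(r) by B E leaves only powers of B, E and B(r), which agree on both
  -- sides.
  rw [hratio, eq_one_div_of_mul_eq_one_left hABC, hEr]
  field_simp
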